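/- **Online transductive matrix completion with a trace-norm constraint.** Let $B\ge 0$ and $\rho>0$, let $Y\subseteq\mathbb R$ be the set of possible outcomes, and let $\ell(\hat y,y)$ be a loss such that, for every $y\in Y$, the function $\ell(\cdot,y)$ is convex and $\rho$-Lipschitz on $[-B,B]$ (for example, convex and $\rho$-Lipschitz on $\mathbb R$). Let $\|\cdot\|_\Sigma$ be the trace norm (sum of the singular values) and $\|\cdot\|_\sigma$ the spectral norm on real $m\times n$ matrices, and $\langle f,x\rangle=\sum_{i,j}f_{ij}x_{ij}$. A sequence of positions in an $m\times n$ matrix is fixed and known before the game; $x_t$ ($t=1,\dots,T$) is the $m\times n$ matrix with a $1$ at the $t$-th position and $0$ elsewhere, so that $\langle f,x_t\rangle$ is the entry of $f$ at that position. At each round $t$ the learner predicts $\hat y_t\in\mathbb R$, the adversary picks $y_t\in Y$, and the learner suffers $\ell(\hat y_t,y_t)$. The regret is $$\mathrm{Reg}_T=\sum_{t=1}^T\ell(\hat y_t,y_t)-\inf_{\|f\|_\Sigma\le B}\sum_{t=1}^T\ell(\langle f,x_t\rangle,y_t).$$ Consider the randomized strategy that at round $t$ draws fresh independent uniform signs $\epsilon_{t+1},\dots,\epsilon_T\in\{\pm1\}$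 (independently of all other rounds) and predicts $$\hat y_t(\epsilon)=\inf_{\|f\|_\Sigma\le B}\Big\{-\sum_{i=t+1}^T\epsilon_i\langle f,x_i\rangle+\tfrac1{2\rho}\sum_{i=1}^{t-1}\ell(\langle f,x_i\rangle,y_i)+\tfrac12\langle f,x_t\rangle\Big\}-\inf_{\|f\|_\Sigma\le B}\Big\{-\sum_{i=t+1}^T\epsilon_i\langle f,x_i\rangle+\tfrac1{2\rho}\sum_{i=1}^{t-1}\ell(\langle f,x_i\rangle,y_i)-\tfrac12\langle f,x_t\rangle\Big\}.$$ Then: 1. At every round the two minimization problems are convex programs (the set $\{\|f\|_\Sigma\le B\}$ is convex and both objectives are convex on it) whose minima are attained, so $\hat y_t$ is the difference of the two minimal values. 2. For every adversary, where $y_t$ may depend on the learner's draws and predictions in rounds $1,\dots,t-1$, $$\mathbb E[\mathrm{Reg}_T]\le 2B\rho\;\mathbb E_\epsilon\Big\|\sum_{t=1}^T\epsilon_tx_t\Big\|_\sigma ,$$ where $\epsilon_1,\dots,\epsilon_T$ are independent uniform signs. 3. If the positions are pairwise distinct (no entry is asked for twice), then $$2B\rho\;\mathbb E_\epsilon\Big\|\sum_{t=1}^T\epsilon_tx_t\Big\|_\sigma\le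 C\,B\rho\,(\sqrt m+\sqrt n)$$ with an absolute constant $C$, independent of $m,n,T,B,\rho,\ell$, the positions and the outcomes. -/

import Mathlib

open scoped BigOperators

noncomputable section

namespace MatrixCompletion

/-- The linear map of Euclidean spaces `ℝⁿ → ℝᵐ` given by a real `m × n` matrix. -/
def toMap {m n : ℕ} (A : Matrix (Fin m) (Fin n) ℝ) :
    EuclideanSpace ℝ (Fin n) →ₗ[ℝ] EuclideanSpace ℝ (Fin m) :=
  Matrix.toEuclideanLin A

/-- The trace norm (nuclear norm): the sum of the singular values. -/
def traceNorm {m n : ℕ} (A : Matrix (Fin m) (Fin n) ℝ) : ℝ :=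
  ∑ k ∈ Finset.range n, (toMap A).singularValues k

/-- The spectral norm: the operator norm with respect to the Euclidean norms. -/
def spectralNorm {m n : ℕ} (A : Matrix (Fin m) (Fin n) ℝ) : ℝ :=
  ‖(toMap A).toContinuousLinearMap‖

/-- The comparison class: the matrices of trace norm at most `B`. -/
def traceBall (m n : ℕ) (B : ℝ) : Set (Matrix (Fin m) (Fin n) ℝ) :=
  {f | traceNorm f ≤ B}

/-- The entrywise (Frobenius) inner product of two matrices. -/
def ip {m n : ℕ} (f x : Matrix (Fin m) (Fin n) ℝ) : ℝ :=
  ∑ i, ∑ j, f i j * x i j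

/-- The matrix `x` that has a `1` at position `p` and `0` elsewhere. -/
def entry {m n : ℕ} (p : Fin m × Fin n) : Matrix (Fin m) (Fin n) ℝ :=
  Matrix.single p.1 p.2 1

/-- Patterns of `T` signs in `{1, -1}`. -/
abbrev Signs (T : ℕ) : Type := Fin T → ℤˣ

/-- The real number `1` or `-1` given by a sign. -/
def sgn (e : ℤˣ) : ℝ := ((e : ℤ) : ℝ)

variable {m n T : ℕ}

/-- The objective that is minimized at round `t`, with the sign `c` (`c = 1` or `c = -1`)
in front of the term `⟨f, x_t⟩ / 2`:
`- ∑_{i > t} ε_i ⟨f, x_i⟩ + (1 / (2ρ)) ∑_{i < t} ℓ(⟨f, x_i⟩, y_i) + c ⟨f, x_t⟩ / 2`.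
The first argument of the loss is the prediction, the second one is the outcome. -/
def objective (pos : Fin T → Fin m × Fin n) (ρ : ℝ) (ℓ : ℝ → ℝ → ℝ) (ε : Signs T)
    (y : Fin T → ℝ) (t : Fin T) (c : ℝ) (f : Matrix (Fin m) (Fin n) ℝ) : ℝ :=
  -(∑ i ∈ Finset.Ioi t, sgn (ε i) * ip f (entry (pos i)))
    + 1 / (2 * ρ) * (∑ i ∈ Finset.Iio t, ℓ (ip f (entry (pos i))) (y i))
    + c * (1 / 2) * ip f (entry (pos t))

/-- The prediction at round `t`, computed from the signs `ε_i`, `i > t`, and the earlier outcomes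
`y_i`, `i < t`: the difference of the optimal values of two programs over the trace-norm ball. -/
def prediction (B : ℝ) (pos : Fin T → Fin m × Fin n) (ρ : ℝ) (ℓ : ℝ → ℝ → ℝ) (ε : Signs T)
    (y : Fin T → ℝ) (t : Fin T) : ℝ :=
  (⨅ f : traceBall m n B, objective pos ρ ℓ ε y t 1 f.1)
    - ⨅ f : traceBall m n B, objective pos ρ ℓ ε y t (-1) f.1

/-- An adversary with outcomes in `Y`. Here `ω t` is the sign pattern drawn by the learner at
round `t`, and `y ω t` is the outcome played at round `t`. The adversary may adapt to everything the
learner drew (hence to everything the learner predicted) in the earlier rounds, but does not see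
the draws of the present and later rounds. -/
structure IsAdversary (Y : Set ℝ) (y : (Fin T → Signs T) → Fin T → ℝ) : Prop where
  mem : ∀ ω t, y ω t ∈ Y
  nonanticipating : ∀ t ω ω', (∀ s, s < t → ω s = ω' s) → y ω t = y ω' t

/-- The regret against the trace-norm ball on the realization `ω` of the learner's draws. -/
def regret (B : ℝ) (pos : Fin T → Fin m × Fin n) (ρ : ℝ) (ℓ : ℝ → ℝ → ℝ)
    (y : (Fin T → Signs T) → Fin T → ℝ) (ω : Fin T → Signs T) : ℝ :=
  (∑ t, ℓ (prediction B pos ρ ℓ (ω t) (y ω) t) (y ω t))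
    - ⨅ f : traceBall m n B, ∑ t, ℓ (ip f.1 (entry (pos t))) (y ω t)

/-- The expected regret. The learner draws a fresh, uniformly distributed sign pattern at every
round, independently of the other rounds; so `ω` is uniform on `Fin T → Signs T`. -/
def expectedRegret (B : ℝ) (pos : Fin T → Fin m × Fin n) (ρ : ℝ) (ℓ : ℝ → ℝ → ℝ)
    (y : (Fin T → Signs T) → Fin T → ℝ) : ℝ :=
  𝔼 ω : Fin T → Signs T, regret B pos ρ ℓ y ω

/-- `E ‖∑ₜ εₜ xₜ‖_σ` for independent uniform signs `εₜ`. -/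
def expectedSpectralNorm (pos : Fin T → Fin m × Fin n) : ℝ :=
  𝔼 ε : Signs T, spectralNorm (∑ t, sgn (ε t) • entry (pos t))

end MatrixCompletion

end

open scoped BigOperators

noncomputable section

namespace MatrixCompletion

variable {m n T : ℕ}

open scoped RealInnerProductSpace

/-! The regret bound is a potential argument with random playout. For fixed signs put `S s = ⨆ f, (A
f + s * g f)`, where `A` is `partialGain` (the signed future entries times `2ρ`, minus past losses)
and `g f` is the current entry. Up to the factor `2ρ`, the prediction is `S ρ - S (-ρ)`. By the
Lipschitz property it guarantees, whatever the outcome, that the loss plus the next supremum is at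
most `(S ρ + S (-ρ)) / 2`. Convexity of `S` bounds this by `(S (2ρ) + S (-2ρ)) / 2`, the average
over the current sign of the supremum before the round. Hence the expected loss is at most the drop
of `potential`, and the rounds telescope: the last potential is minus the comparator's loss, and the
initial one is bounded by trace/spectral duality (`loss_add_iSup_le_of_balanced`, `expect_round_le`,
`potential_zero_le`).

The same duality writes the trace-norm ball as an intersection of half-spaces, so it is convex and
compact and the minima exist.

For the rate, half-nets of the two unit balls reduce the spectral norm to at most `5 ^ (m + n)`
bilinear forms. Each is a Rademacher sum, subgaussian with variance proxy at most `1` when the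
positions are distinct. An exponential moment bound finishes (`expect_exp_mul_spectralNorm_le`). -/

/-! ### Duality of trace and spectral norm; geometry of the trace-norm ball. -/

lemma toMap_single_apply (A : Matrix (Fin m) (Fin n) ℝ) (i : Fin m) (j : Fin n) :
    toMap A (EuclideanSpace.single j 1) i = A i j := by
  simp [toMap, Matrix.toLpLin_apply]

/-- Both sides are the trace of `AᵀX`, which does not depend on the orthonormal basis. -/
lemma ip_eq_sum_inner {ι : Type*} [Fintype ι]
    (b : OrthonormalBasis ι ℝ (EuclideanSpace ℝ (Fin n))) (A X : Matrix (Fin m) (Fin n) ℝ) :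
    ip A X = ∑ k, ⟪toMap A (b k), toMap X (b k)⟫ := by
  let M := LinearMap.adjoint (toMap A) ∘ₗ toMap X
  have h := (LinearMap.trace_eq_sum_inner M (EuclideanSpace.basisFun (Fin n) ℝ)).symm.trans
    (LinearMap.trace_eq_sum_inner M b)
  simp only [M, LinearMap.comp_apply, LinearMap.adjoint_inner_right] at h
  rw [← h, ip, Finset.sum_comm]
  refine Finset.sum_congr rfl fun k _ => ?_
  rw [PiLp.inner_apply]
  refine Finset.sum_congr rfl fun i _ => ?_
  simp [toMap_single_apply, mul_comm]

/-- An orthonormal basis of right singular vectors. -/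
def rightSingularBasis (A : Matrix (Fin m) (Fin n) ℝ) :
    OrthonormalBasis (Fin n) ℝ (EuclideanSpace ℝ (Fin n)) :=
  (toMap A).isSymmetric_adjoint_comp_self.eigenvectorBasis finrank_euclideanSpace_fin

lemma inner_toMap_rightSingularBasis (A : Matrix (Fin m) (Fin n) ℝ) (k l : Fin n) :
    ⟪toMap A (rightSingularBasis A k), toMap A (rightSingularBasis A l)⟫ =
      if k = l then (toMap A).singularValues k ^ 2 else 0 := by
  have hl : LinearMap.adjoint (toMap A) (toMap A (rightSingularBasis A l)) =
      ((toMap A).isSymmetric_adjoint_comp_self.eigenvalues finrank_euclideanSpace_fin l : ℝ) •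
        rightSingularBasis A l :=
    (toMap A).isSymmetric_adjoint_comp_self.apply_eigenvectorBasis finrank_euclideanSpace_fin l
  rw [← LinearMap.adjoint_inner_right, hl, inner_smul_right, OrthonormalBasis.inner_eq_ite,
    ← LinearMap.sq_singularValues_fin (toMap A) finrank_euclideanSpace_fin l]
  split_ifs with h
  · rw [h, mul_one]
  · rw [mul_zero]

lemma norm_toMap_apply_le (X : Matrix (Fin m) (Fin n) ℝ) (v : EuclideanSpace ℝ (Fin n)) :
    ‖toMap X v‖ ≤ spectralNorm X * ‖v‖ :=
  (toMap X).toContinuousLinearMap.le_opNorm v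

lemma spectralNorm_nonneg (X : Matrix (Fin m) (Fin n) ℝ) : 0 ≤ spectralNorm X :=
  norm_nonneg _

lemma norm_toMap_rightSingularBasis (A : Matrix (Fin m) (Fin n) ℝ) (k : Fin n) :
    ‖toMap A (rightSingularBasis A k)‖ = (toMap A).singularValues k := by
  have h := inner_toMap_rightSingularBasis A k k
  rw [if_pos rfl, real_inner_self_eq_norm_sq] at h
  exact (sq_eq_sq₀ (norm_nonneg _) (LinearMap.singularValues_nonneg _ _)).1 h

lemma traceNorm_eq_sum_fin (A : Matrix (Fin m) (Fin n) ℝ) :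
    traceNorm A = ∑ k : Fin n, (toMap A).singularValues k :=
  Finset.sum_range _

lemma ip_le_traceNorm_mul_spectralNorm (A X : Matrix (Fin m) (Fin n) ℝ) :
    ip A X ≤ traceNorm A * spectralNorm X := by
  rw [ip_eq_sum_inner (rightSingularBasis A), traceNorm_eq_sum_fin, Finset.sum_mul]
  refine Finset.sum_le_sum fun k _ => (real_inner_le_norm _ _).trans ?_
  rw [norm_toMap_rightSingularBasis]
  refine mul_le_mul_of_nonneg_left ?_ (LinearMap.singularValues_nonneg _ _)
  simpa using norm_toMap_apply_le X (rightSingularBasis A k)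

/-- The trace norm is attained in its dual representation by a contraction. -/
lemma exists_spectralNorm_le_one_ip_eq_traceNorm (A : Matrix (Fin m) (Fin n) ℝ) :
    ∃ X : Matrix (Fin m) (Fin n) ℝ, spectralNorm X ≤ 1 ∧ ip A X = traceNorm A := by
  set b := rightSingularBasis A with hb
  set σ : Fin n → ℝ := fun k => (toMap A).singularValues k with hσ
  -- The partial isometry of the polar decomposition; since `0⁻¹ = 0`, it vanishes on the singular
  -- vectors with `σ k = 0`.
  let L : EuclideanSpace ℝ (Fin n) →ₗ[ℝ] EuclideanSpace ℝ (Fin m) :=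
    b.toBasis.constr ℝ fun k => (σ k)⁻¹ • toMap A (b k)
  have hL : ∀ k, L (b k) = (σ k)⁻¹ • toMap A (b k) := fun k => by
    have h := b.toBasis.constr_basis ℝ (fun k => (σ k)⁻¹ • toMap A (b k)) k
    rwa [OrthonormalBasis.coe_toBasis] at h
  have hX : toMap (Matrix.toEuclideanLin.symm L) = L := by simp [toMap]
  refine ⟨Matrix.toEuclideanLin.symm L, ?_, ?_⟩
  · rw [spectralNorm, hX]
    refine ContinuousLinearMap.opNorm_le_bound _ zero_le_one fun v => ?_
    rw [one_mul, LinearMap.coe_toContinuousLinearMap']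
    refine abs_le_of_sq_le_sq' ?_ (norm_nonneg _) |>.2
    have hv : L v = ∑ k, (⟪b k, v⟫ * (σ k)⁻¹) • toMap A (b k) := by
      conv_lhs => rw [← b.sum_repr' v]
      simp [map_sum, hL, smul_smul]
    rw [← real_inner_self_eq_norm_sq, hv, sum_inner, ← b.sum_sq_inner_right v]
    refine Finset.sum_le_sum fun k _ => ?_
    rw [inner_sum]
    simp only [inner_smul_left, inner_smul_right, hb, inner_toMap_rightSingularBasis]
    rw [Finset.sum_eq_single k (by intro l _ hl; simp [hl.symm]) (by simp)]
    by_cases h : σ k = 0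
    · simp [h, sq_nonneg]
    · have h2 : (toMap A).singularValues k = σ k := rfl
      simp only [conj_trivial, if_pos, h2]
      apply le_of_eq
      field_simp
  · rw [ip_eq_sum_inner b, hX, traceNorm_eq_sum_fin]
    refine Finset.sum_congr rfl fun k _ => ?_
    rw [hL, inner_smul_right, hb, inner_toMap_rightSingularBasis, if_pos rfl]
    by_cases h : σ k = 0
    · have h2 : (toMap A).singularValues k = 0 := h
      simp [h2]
    · have h2 : (toMap A).singularValues k = σ k := rfl
      rw [h2]
      field_simp

lemma traceNorm_nonneg (A : Matrix (Fin m) (Fin n) ℝ) : 0 ≤ traceNorm A :=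
  Finset.sum_nonneg fun k _ => LinearMap.singularValues_nonneg _ k

lemma traceNorm_zero : traceNorm (0 : Matrix (Fin m) (Fin n) ℝ) = 0 := by
  simp [traceNorm, toMap]

/-- Duality turns the ball into an intersection of closed half-spaces, so convexity and closedness
need no triangle inequality for singular values. -/
lemma traceBall_eq_iInter (B : ℝ) :
    traceBall m n B =
      ⋂ X ∈ {X : Matrix (Fin m) (Fin n) ℝ | spectralNorm X ≤ 1}, {A | ip A X ≤ B} := by
  ext A
  simp only [traceBall, Set.mem_ofPred_eq, Set.mem_iInter]
  constructor
  · intro h X hX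
    refine (ip_le_traceNorm_mul_spectralNorm A X).trans (le_trans ?_ h)
    exact mul_le_of_le_one_right (traceNorm_nonneg A) hX
  · intro h
    obtain ⟨X, hX, hA⟩ := exists_spectralNorm_le_one_ip_eq_traceNorm A
    exact hA ▸ h X hX

/-- The pairing with a fixed matrix, as a linear functional. -/
def ipLin (X : Matrix (Fin m) (Fin n) ℝ) : Matrix (Fin m) (Fin n) ℝ →ₗ[ℝ] ℝ where
  toFun A := ip A X
  map_add' A A' := by simp [ip, add_mul, Finset.sum_add_distrib]
  map_smul' c A := by simp [ip, Finset.mul_sum, mul_assoc]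

@[simp] lemma ipLin_apply (A X : Matrix (Fin m) (Fin n) ℝ) : ipLin X A = ip A X := rfl

lemma continuous_ip (X : Matrix (Fin m) (Fin n) ℝ) : Continuous fun A => ip A X := by
  unfold ip
  fun_prop

lemma convex_traceBall (m n : ℕ) (B : ℝ) : Convex ℝ (traceBall m n B) := by
  rw [traceBall_eq_iInter]
  exact convex_iInter₂ fun X _ => convex_halfSpace_le (ipLin X).isLinear B

lemma isClosed_traceBall (m n : ℕ) (B : ℝ) : IsClosed (traceBall m n B) := by
  rw [traceBall_eq_iInter]
  exact isClosed_biInter fun X _ => isClosed_le (continuous_ip X) continuous_const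

lemma ip_entry (A : Matrix (Fin m) (Fin n) ℝ) (p : Fin m × Fin n) :
    ip A (entry p) = A p.1 p.2 := by
  simp [ip, entry, Matrix.single_apply, ite_and]

lemma toMap_entry_apply (p : Fin m × Fin n) (v : EuclideanSpace ℝ (Fin n)) :
    toMap (entry p) v = v p.2 • EuclideanSpace.single p.1 1 := by
  ext i
  simp [toMap, entry, Matrix.toLpLin_apply, Matrix.single_mulVec, Function.update_apply]

lemma spectralNorm_entry_le (p : Fin m × Fin n) : spectralNorm (entry p) ≤ 1 := by
  refine ContinuousLinearMap.opNorm_le_bound _ zero_le_one fun v => ?_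
  rw [LinearMap.coe_toContinuousLinearMap', toMap_entry_apply, norm_smul, one_mul]
  simpa using PiLp.norm_apply_le v p.2

lemma spectralNorm_neg (X : Matrix (Fin m) (Fin n) ℝ) : spectralNorm (-X) = spectralNorm X := by
  simp [spectralNorm, toMap]

lemma ip_neg (A X : Matrix (Fin m) (Fin n) ℝ) : ip A (-X) = -ip A X := by
  simp [ip]

lemma ip_entry_mem_Icc {B : ℝ} {A : Matrix (Fin m) (Fin n) ℝ} (hA : A ∈ traceBall m n B)
    (p : Fin m × Fin n) : ip A (entry p) ∈ Set.Icc (-B) B := by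
  rw [traceBall_eq_iInter, Set.mem_iInter₂] at hA
  have h1 : ip A (entry p) ≤ B := hA (entry p) (spectralNorm_entry_le p)
  have h2 : ip A (-entry p) ≤ B :=
    hA (-entry p) ((spectralNorm_neg _).trans_le (spectralNorm_entry_le p))
  rw [ip_neg] at h2
  exact ⟨by linarith, h1⟩

lemma isCompact_traceBall (m n : ℕ) (B : ℝ) : IsCompact (traceBall m n B) := by
  refine IsCompact.of_isClosed_subset (s := Set.univ.pi fun _ => Set.univ.pi fun _ =>
    Set.Icc (-B) B) ?_ (isClosed_traceBall m n B) ?_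
  · exact isCompact_univ_pi fun _ => isCompact_univ_pi fun _ => isCompact_Icc
  · intro A hA i _ j _
    have h := ip_entry_mem_Icc hA (i, j)
    have h' : ip A (entry (i, j)) = A i j := ip_entry A (i, j)
    exact ⟨h.1.trans_eq h', h'.symm.trans_le h.2⟩

lemma zero_mem_traceBall {B : ℝ} (hB : 0 ≤ B) : (0 : Matrix (Fin m) (Fin n) ℝ) ∈ traceBall m n B :=
  traceNorm_zero.trans_le hB

/-! ### The two convex programs of a round. -/

section Objective

variable {B ρ : ℝ} {Y : Set ℝ} {ℓ : ℝ → ℝ → ℝ}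

lemma continuousOn_loss (hlip : ∀ y ∈ Y, LipschitzOnWith ρ.toNNReal (fun a => ℓ a y)
    (Set.Icc (-B) B)) {y : ℝ} (hy : y ∈ Y) (p : Fin m × Fin n) :
    ContinuousOn (fun f => ℓ (ip f (entry p)) y) (traceBall m n B) :=
  (hlip y hy).continuousOn.comp (continuous_ip (entry p)).continuousOn
    fun _ hf => ip_entry_mem_Icc hf p

lemma convexOn_loss (hconv : ∀ y ∈ Y, ConvexOn ℝ (Set.Icc (-B) B) (fun a => ℓ a y))
    {y : ℝ} (hy : y ∈ Y) (p : Fin m × Fin n) :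
    ConvexOn ℝ (traceBall m n B) (fun f => ℓ (ip f (entry p)) y) :=
  ((hconv y hy).comp_linearMap (ipLin (entry p))).subset
    (fun _ hf => ip_entry_mem_Icc hf p) (convex_traceBall m n B)

lemma continuousOn_objective (hlip : ∀ y ∈ Y, LipschitzOnWith ρ.toNNReal (fun a => ℓ a y)
    (Set.Icc (-B) B)) (pos : Fin T → Fin m × Fin n) (ε : Signs T) {y : Fin T → ℝ}
    (hy : ∀ i, y i ∈ Y) (t : Fin T) (c : ℝ) :
    ContinuousOn (objective pos ρ ℓ ε y t c) (traceBall m n B) := by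
  unfold objective
  have h : ∀ i, Continuous fun f : Matrix (Fin m) (Fin n) ℝ => ip f (entry (pos i)) :=
    fun i => continuous_ip _
  refine ((Continuous.continuousOn (by fun_prop)).add (continuousOn_const.mul ?_)).add
    (Continuous.continuousOn (by fun_prop))
  exact continuousOn_finsetSum _ fun i _ => continuousOn_loss hlip (hy i) (pos i)

lemma convexOn_objective (hρ : 0 < ρ)
    (hconv : ∀ y ∈ Y, ConvexOn ℝ (Set.Icc (-B) B) (fun a => ℓ a y))
    (pos : Fin T → Fin m × Fin n) (ε : Signs T) {y : Fin T → ℝ}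
    (hy : ∀ i, y i ∈ Y) (t : Fin T) (c : ℝ) :
    ConvexOn ℝ (traceBall m n B) (objective pos ρ ℓ ε y t c) := by
  have hlin : ∀ L : Matrix (Fin m) (Fin n) ℝ →ₗ[ℝ] ℝ, ConvexOn ℝ (traceBall m n B) L :=
    fun L => L.convexOn (convex_traceBall m n B)
  have hsum : ConvexOn ℝ (traceBall m n B)
      fun f => ∑ i ∈ Finset.Iio t, ℓ (ip f (entry (pos i))) (y i) := by
    induction Finset.Iio t using Finset.cons_induction with
    | empty => simpa using convexOn_const 0 (convex_traceBall m n B)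
    | cons a s ha ih =>
      simp only [Finset.sum_cons]
      exact (convexOn_loss hconv (hy a) (pos a)).add ih
  refine (((hlin (-∑ i ∈ Finset.Ioi t, sgn (ε i) • ipLin (entry (pos i)))).add
    (hsum.smul (c := 1 / (2 * ρ)) (by positivity))).add
    (hlin ((c * (1 / 2)) • ipLin (entry (pos t))))).congr fun f _ => ?_
  simp [objective]

lemma bddBelow_range_of_continuousOn {g : Matrix (Fin m) (Fin n) ℝ → ℝ}
    (hg : ContinuousOn g (traceBall m n B)) :
    BddBelow (Set.range fun f : traceBall m n B => g f.1) := by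
  have h := (isCompact_traceBall m n B).bddBelow_image hg
  rwa [Set.image_eq_range] at h

lemma bddAbove_range_of_continuousOn {g : Matrix (Fin m) (Fin n) ℝ → ℝ}
    (hg : ContinuousOn g (traceBall m n B)) :
    BddAbove (Set.range fun f : traceBall m n B => g f.1) := by
  have h := (isCompact_traceBall m n B).bddAbove_image hg
  rwa [Set.image_eq_range] at h

lemma exists_isMinOn_traceBall (hB : 0 ≤ B) {g : Matrix (Fin m) (Fin n) ℝ → ℝ}
    (hg : ContinuousOn g (traceBall m n B)) :
    ∃ f ∈ traceBall m n B, IsMinOn g (traceBall m n B) f ∧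
      ⨅ h : traceBall m n B, g h.1 = g f := by
  obtain ⟨f, hf, hmin⟩ :=
    (isCompact_traceBall m n B).exists_isMinOn ⟨0, zero_mem_traceBall hB⟩ hg
  have : Nonempty (traceBall m n B) := ⟨⟨f, hf⟩⟩
  refine ⟨f, hf, hmin, le_antisymm (ciInf_le (bddBelow_range_of_continuousOn hg) ⟨f, hf⟩) ?_⟩
  exact le_ciInf fun h => hmin h.2

end Objective

lemma sgn_eq_or (e : ℤˣ) : sgn e = 1 ∨ sgn e = -1 := by
  rcases Int.units_eq_one_or e with rfl | rfl <;> simp [sgn]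

lemma sgn_neg (e : ℤˣ) : sgn (-e) = -sgn e := by simp [sgn]

/-! ### One round of the game for fixed signs. -/

section Step

variable {F : Type*} {A g : F → ℝ} {B ρ : ℝ}

lemma bddAbove_range_add_mul (hA : BddAbove (Set.range A)) (hg : ∀ f, g f ∈ Set.Icc (-B) B)
    (s : ℝ) : BddAbove (Set.range fun f => A f + s * g f) := by
  obtain ⟨M, hM⟩ := hA
  refine ⟨M + |s| * B, ?_⟩
  rintro _ ⟨f, rfl⟩
  refine add_le_add (hM ⟨f, rfl⟩) ((le_abs_self _).trans ?_)
  rw [abs_mul]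
  exact mul_le_mul_of_nonneg_left (abs_le.2 (hg f)) (abs_nonneg s)

lemma iSup_add_mul_le_add [Nonempty F] (hA : BddAbove (Set.range A))
    (hg : ∀ f, g f ∈ Set.Icc (-B) B) (s r : ℝ) :
    ⨆ f, (A f + s * g f) ≤ (⨆ f, (A f + r * g f)) + |s - r| * B := by
  refine ciSup_le fun f => ?_
  have h1 := le_ciSup (bddAbove_range_add_mul hA hg r) f
  have h2 : (s - r) * g f ≤ |s - r| * B := by
    refine (le_abs_self _).trans ?_
    rw [abs_mul]
    exact mul_le_mul_of_nonneg_left (abs_le.2 (hg f)) (abs_nonneg _)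
  linarith

/-- The value of a prediction that balances two perturbed suprema, against any outcome. -/
lemma loss_add_iSup_le_of_balanced [Nonempty F] (hρ : 0 < ρ) (hA : BddAbove (Set.range A))
    (hg : ∀ f, g f ∈ Set.Icc (-B) B) {L : ℝ → ℝ}
    (hL : LipschitzOnWith ρ.toNNReal L (Set.Icc (-B) B)) {p : ℝ}
    (hp : 2 * ρ * p = (⨆ f, (A f + ρ * g f)) - ⨆ f, (A f + -ρ * g f)) :
    L p + ⨆ f, (A f - L (g f)) ≤
      1 / 2 * ((⨆ f, (A f + 2 * ρ * g f)) + ⨆ f, (A f + -(2 * ρ) * g f)) := by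
  have hle : ∀ s f, A f + s * g f ≤ ⨆ f, (A f + s * g f) := fun s f =>
    le_ciSup (bddAbove_range_add_mul hA hg s) f
  -- The supremum is `B`-Lipschitz in the slope `s`, and the two slopes differ by `2ρ`. The loss is
  -- controlled only on `[-B, B]`, so `p` has to lie there.
  have hpB : p ∈ Set.Icc (-B) B := by
    have h1 := iSup_add_mul_le_add hA hg ρ (-ρ)
    have h2 := iSup_add_mul_le_add hA hg (-ρ) ρ
    rw [show ρ - -ρ = 2 * ρ by ring, abs_of_pos (by positivity)] at h1
    rw [show -ρ - ρ = -(2 * ρ) by ring, abs_neg, abs_of_pos (by positivity)] at h2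
    constructor
    · have : 2 * ρ * (-B) ≤ 2 * ρ * p := by linarith
      exact le_of_mul_le_mul_left this (by positivity)
    · have : 2 * ρ * p ≤ 2 * ρ * B := by linarith
      exact le_of_mul_le_mul_left this (by positivity)
  -- Convexity in the slope: `ρ = 3/4 * (2ρ) + 1/4 * (-2ρ)`.
  have hpos : ⨆ f, (A f + ρ * g f) ≤
      3 / 4 * (⨆ f, (A f + 2 * ρ * g f)) + 1 / 4 * ⨆ f, (A f + -(2 * ρ) * g f) :=
    ciSup_le fun f => by linarith [hle (2 * ρ) f, hle (-(2 * ρ)) f]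
  have hneg : ⨆ f, (A f + -ρ * g f) ≤
      1 / 4 * (⨆ f, (A f + 2 * ρ * g f)) + 3 / 4 * ⨆ f, (A f + -(2 * ρ) * g f) :=
    ciSup_le fun f => by linarith [hle (2 * ρ) f, hle (-(2 * ρ)) f]
  rw [← le_sub_iff_add_le']
  refine ciSup_le fun f => ?_
  have hlip : L p - L (g f) ≤ ρ * |p - g f| := by
    have h := hL.dist_le_mul p hpB (g f) (hg f)
    rw [Real.coe_toNNReal _ hρ.le, Real.dist_eq, Real.dist_eq] at h
    exact (le_abs_self _).trans h
  have h1 := hle ρ f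
  have h2 := hle (-ρ) f
  -- According to the sign of `p - g f`, the left side is at most `A f - ρ * g f + ρ * p` or `A f +
  -- ρ * g f - ρ * p`; by the choice of `p`, both are at most the mean of the suprema at slopes `ρ`
  -- and `-ρ`.
  rcases abs_cases (p - g f) with ⟨h, -⟩ | ⟨h, -⟩ <;> rw [h] at hlip <;> linarith

end Step

/-! ### The random-playout potential and the regret bound. -/

section Regret

variable (B ρ : ℝ) (pos : Fin T → Fin m × Fin n) (ℓ : ℝ → ℝ → ℝ)

/-- The signed future entries minus the losses of the first `k` rounds. -/
def gain (k : ℕ) (ε : Signs T) (y : Fin T → ℝ) (f : Matrix (Fin m) (Fin n) ℝ) : ℝ :=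
  2 * ρ * (∑ i with k ≤ i.val, sgn (ε i) * ip f (entry (pos i)))
    - ∑ i with i.val < k, ℓ (ip f (entry (pos i))) (y i)

/-- The part of the gain at round `t` that does not involve the entry of this round. -/
def partialGain (t : Fin T) (ε : Signs T) (y : Fin T → ℝ) (f : Matrix (Fin m) (Fin n) ℝ) : ℝ :=
  2 * ρ * (∑ i ∈ Finset.Ioi t, sgn (ε i) * ip f (entry (pos i)))
    - ∑ i ∈ Finset.Iio t, ℓ (ip f (entry (pos i))) (y i)

/-- The random-playout relaxation of the value of the game after `k` rounds. -/
def potential (k : ℕ) (y : Fin T → ℝ) : ℝ :=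
  𝔼 ε : Signs T, ⨆ f : traceBall m n B, gain ρ pos ℓ k ε y f.1

variable {B ρ pos ℓ}

lemma gain_eq_partialGain_add (t : Fin T) (ε : Signs T) (y : Fin T → ℝ)
    (f : Matrix (Fin m) (Fin n) ℝ) :
    gain ρ pos ℓ t ε y f =
      partialGain ρ pos ℓ t ε y f + 2 * ρ * sgn (ε t) * ip f (entry (pos t)) := by
  have h1 : ({i | t.val ≤ i.val} : Finset (Fin T)) = insert t (Finset.Ioi t) := by
    ext i; simp [le_iff_eq_or_lt, Fin.ext_iff]
  have h2 : ({i | i.val < t.val} : Finset (Fin T)) = Finset.Iio t := by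
    ext i; simp
  rw [gain, partialGain, h1, h2, Finset.sum_insert (by simp)]
  ring

lemma gain_succ_eq_partialGain_sub (t : Fin T) (ε : Signs T) (y : Fin T → ℝ)
    (f : Matrix (Fin m) (Fin n) ℝ) :
    gain ρ pos ℓ (t + 1) ε y f =
      partialGain ρ pos ℓ t ε y f - ℓ (ip f (entry (pos t))) (y t) := by
  have h1 : ({i | t.val + 1 ≤ i.val} : Finset (Fin T)) = Finset.Ioi t := by
    ext i; simp
  have h2 : ({i | i.val < t.val + 1} : Finset (Fin T)) = insert t (Finset.Iio t) := by
    ext i; simp [le_iff_eq_or_lt, Fin.ext_iff]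
  rw [gain, partialGain, h1, h2, Finset.sum_insert (by simp)]
  ring

lemma objective_eq (hρ : 0 < ρ) (ε : Signs T) (y : Fin T → ℝ) (t : Fin T) (c : ℝ)
    (f : Matrix (Fin m) (Fin n) ℝ) :
    objective pos ρ ℓ ε y t c f =
      -(1 / (2 * ρ) * (partialGain ρ pos ℓ t ε y f + -c * ρ * ip f (entry (pos t)))) := by
  rw [objective, partialGain]
  field_simp
  ring

lemma two_mul_prediction (hρ : 0 < ρ) (ε : Signs T) (y : Fin T → ℝ) (t : Fin T) :
    2 * ρ * prediction B pos ρ ℓ ε y t =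
      (⨆ f : traceBall m n B, (partialGain ρ pos ℓ t ε y f.1 + ρ * ip f.1 (entry (pos t))))
        - ⨆ f : traceBall m n B,
          (partialGain ρ pos ℓ t ε y f.1 + -ρ * ip f.1 (entry (pos t))) := by
  have h : ∀ c, ⨅ f : traceBall m n B, objective pos ρ ℓ ε y t c f.1 =
      -(1 / (2 * ρ) * ⨆ f : traceBall m n B,
        (partialGain ρ pos ℓ t ε y f.1 + -c * ρ * ip f.1 (entry (pos t)))) := fun c => by
    -- These identities for real suprema and infima also hold at the default values, so neither
    -- boundedness nor nonemptiness is needed.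
    rw [Real.mul_iSup_of_nonneg (by positivity), iSup, ← Real.sInf_neg, iInf]
    congr 1
    ext x
    simp only [Set.mem_range, Set.mem_neg, objective_eq hρ]
    exact exists_congr fun f => by rw [neg_eq_iff_eq_neg]
  rw [prediction, h, h]
  simp only [neg_neg, one_mul, neg_mul]
  field_simp
  ring

lemma prediction_congr (ε : Signs T) {y y' : Fin T → ℝ} (t : Fin T)
    (h : ∀ s, s < t → y s = y' s) :
    prediction B pos ρ ℓ ε y t = prediction B pos ρ ℓ ε y' t := by
  have : ∀ c, objective pos ρ ℓ ε y t c = objective pos ρ ℓ ε y' t c := fun c => by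
    ext f
    unfold objective
    congr 3
    exact Finset.sum_congr rfl fun i hi => by rw [h i (Finset.mem_Iio.1 hi)]
  simp only [prediction, this]

variable {Y : Set ℝ}

lemma bddAbove_range_partialGain (hlip : ∀ y ∈ Y, LipschitzOnWith ρ.toNNReal (fun a => ℓ a y)
    (Set.Icc (-B) B)) (ε : Signs T) {y : Fin T → ℝ} (hy : ∀ i, y i ∈ Y) (t : Fin T) :
    BddAbove (Set.range fun f : traceBall m n B => partialGain ρ pos ℓ t ε y f.1) := by
  refine bddAbove_range_of_continuousOn ?_
  unfold partialGain
  have h : ∀ i, Continuous fun f : Matrix (Fin m) (Fin n) ℝ => ip f (entry (pos i)) :=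
    fun i => continuous_ip _
  refine (Continuous.continuousOn (by fun_prop)).sub ?_
  exact continuousOn_finsetSum _ fun i _ => continuousOn_loss hlip (hy i) (pos i)

/-- Reverse the sign of coordinate `t`. -/
def flipSign (t : Fin T) (ε : Signs T) : Signs T := ε * Pi.mulSingle t (-1)

lemma gain_flipSign (t : Fin T) (ε : Signs T) (y : Fin T → ℝ)
    (f : Matrix (Fin m) (Fin n) ℝ) :
    gain ρ pos ℓ t (flipSign t ε) y f =
      partialGain ρ pos ℓ t ε y f + 2 * ρ * -sgn (ε t) * ip f (entry (pos t)) := by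
  rw [gain_eq_partialGain_add]
  have h1 : sgn (flipSign t ε t) = -sgn (ε t) := by simp [flipSign, sgn_neg]
  have h2 : partialGain ρ pos ℓ t (flipSign t ε) y f = partialGain ρ pos ℓ t ε y f := by
    unfold partialGain
    congr 2
    refine Finset.sum_congr rfl fun i hi => ?_
    have : i ≠ t := (Finset.mem_Ioi.1 hi).ne'
    simp [flipSign, this]
  rw [h1, h2]

lemma expect_flipSign (t : Fin T) (G : Signs T → ℝ) :
    𝔼 ε, G (flipSign t ε) = 𝔼 ε, G ε :=
  Fintype.expect_equiv (Equiv.mulRight (Pi.mulSingle t (-1))) _ _ fun _ => rfl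

/-- The learner's draw and the playout in the potential are coupled through the same `ε`, so the
inequality holds pattern by pattern. The signs after `t` produce the prediction, and pairing `ε`
with `flipSign t ε` averages over the sign at `t`. -/
lemma expect_loss_add_potential_le (hB : 0 ≤ B) (hρ : 0 < ρ)
    (hlip : ∀ y ∈ Y, LipschitzOnWith ρ.toNNReal (fun a => ℓ a y) (Set.Icc (-B) B))
    {y : Fin T → ℝ} (hy : ∀ i, y i ∈ Y) (t : Fin T) :
    (𝔼 ε : Signs T, ℓ (prediction B pos ρ ℓ ε y t) (y t)) + potential B ρ pos ℓ (t + 1) y ≤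
      potential B ρ pos ℓ t y := by
  have : Nonempty (traceBall m n B) := ⟨⟨0, zero_mem_traceBall hB⟩⟩
  have havg : potential B ρ pos ℓ t y = 𝔼 ε : Signs T, 1 / 2 *
      ((⨆ f : traceBall m n B, gain ρ pos ℓ t ε y f.1) +
        ⨆ f : traceBall m n B, gain ρ pos ℓ t (flipSign t ε) y f.1) := by
    rw [← Finset.mul_expect, Finset.expect_add_distrib,
      expect_flipSign t fun ε => ⨆ f : traceBall m n B, gain ρ pos ℓ t ε y f.1, potential]
    ring
  rw [havg, potential, ← Finset.expect_add_distrib]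
  refine Finset.expect_le_expect fun ε _ => ?_
  simp only [gain_succ_eq_partialGain_sub, gain_eq_partialGain_add t ε, gain_flipSign]
  refine (loss_add_iSup_le_of_balanced hρ (bddAbove_range_partialGain hlip ε hy t)
    (fun f => ip_entry_mem_Icc f.2 (pos t)) (hlip (y t) (hy t))
    (two_mul_prediction hρ ε y t)).trans_eq ?_
  rcases sgn_eq_or (ε t) with h | h <;> simp only [h]
  · norm_num
  · norm_num [add_comm]

/-- Multiplying one coordinate of a uniform pattern by an independent uniform element does not
change its law. -/
lemma expect_mul_mulSingle (t : Fin T) (G : (Fin T → Signs T) → ℝ) :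
    𝔼 ω, G ω = 𝔼 ω : Fin T → Signs T, 𝔼 ε : Signs T, G (ω * Pi.mulSingle t ε) := by
  rw [Finset.expect_comm]
  have : ∀ ε : Signs T, 𝔼 ω : Fin T → Signs T, G (ω * Pi.mulSingle t ε) = 𝔼 ω, G ω := fun ε =>
    Fintype.expect_equiv (Equiv.mulRight (Pi.mulSingle t ε)) _ _ fun _ => rfl
  simp [this]

lemma IsAdversary.mul_mulSingle {y : (Fin T → Signs T) → Fin T → ℝ} (hy : IsAdversary Y y)
    {s t : Fin T} (hst : s ≤ t) (ω : Fin T → Signs T) (ε : Signs T) :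
    y (ω * Pi.mulSingle t ε) s = y ω s := by
  refine hy.nonanticipating s _ _ fun r hr => ?_
  simp [(hr.trans_le hst).ne]

/-- Resampling only the draw of round `t` leaves the outcomes up to and including round `t`
unchanged, because the adversary has not seen that draw. Conditionally on `ω` the outcomes are thus
frozen and the one-round bound applies. -/
lemma expect_round_le (hB : 0 ≤ B) (hρ : 0 < ρ)
    (hlip : ∀ y ∈ Y, LipschitzOnWith ρ.toNNReal (fun a => ℓ a y) (Set.Icc (-B) B))
    {y : (Fin T → Signs T) → Fin T → ℝ} (hy : IsAdversary Y y) (t : Fin T) :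
    (𝔼 ω, ℓ (prediction B pos ρ ℓ (ω t) (y ω) t) (y ω t)) +
        𝔼 ω, potential B ρ pos ℓ (t + 1) (y ω) ≤
      𝔼 ω, potential B ρ pos ℓ t (y ω) := by
  rw [expect_mul_mulSingle t, ← Finset.expect_add_distrib]
  refine Finset.expect_le_expect fun ω _ => ?_
  refine le_trans (le_of_eq ?_) (expect_loss_add_potential_le hB hρ hlip (hy.mem ω) t)
  congr 1
  refine Fintype.expect_equiv (Equiv.mulLeft (ω t)) _ _ fun ε => ?_
  rw [hy.mul_mulSingle le_rfl, prediction_congr _ t fun s hs => hy.mul_mulSingle hs.le ω ε]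
  simp

lemma ip_comm (A X : Matrix (Fin m) (Fin n) ℝ) : ip A X = ip X A := by
  simp only [ip, mul_comm]

lemma ip_sum_smul {ι : Type*} (s : Finset ι) (A : Matrix (Fin m) (Fin n) ℝ) (c : ι → ℝ)
    (X : ι → Matrix (Fin m) (Fin n) ℝ) : ip A (∑ t ∈ s, c t • X t) = ∑ t ∈ s, c t * ip A (X t) := by
  simp only [ip_comm A, ← ipLin_apply, map_sum, map_smul, smul_eq_mul]

lemma potential_zero_le (hB : 0 ≤ B) (hρ : 0 < ρ) (y : Fin T → ℝ) :
    potential B ρ pos ℓ 0 y ≤ 2 * B * ρ * expectedSpectralNorm pos := by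
  have : Nonempty (traceBall m n B) := ⟨⟨0, zero_mem_traceBall hB⟩⟩
  rw [potential, expectedSpectralNorm, Finset.mul_expect]
  refine Finset.expect_le_expect fun ε _ => ciSup_le fun f => ?_
  have h : gain ρ pos ℓ 0 ε y f.1 = 2 * ρ * ip f.1 (∑ t, sgn (ε t) • entry (pos t)) := by
    simp [gain, ip_sum_smul]
  rw [h]
  have h1 := ip_le_traceNorm_mul_spectralNorm f.1 (∑ t, sgn (ε t) • entry (pos t))
  have h2 := mul_le_mul_of_nonneg_right (show traceNorm f.1 ≤ B from f.2)
    (spectralNorm_nonneg (∑ t, sgn (ε t) • entry (pos t)))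
  have h3 := mul_le_mul_of_nonneg_left (h1.trans h2) (by positivity : 0 ≤ 2 * ρ)
  linarith

lemma potential_last (y : Fin T → ℝ) :
    potential B ρ pos ℓ T y =
      -⨅ f : traceBall m n B, ∑ t, ℓ (ip f.1 (entry (pos t))) (y t) := by
  have h : ∀ ε f, gain ρ pos ℓ T ε y f = -∑ t, ℓ (ip f (entry (pos t))) (y t) := fun ε f => by
    have h1 : ({i | T ≤ i.val} : Finset (Fin T)) = ∅ := by
      ext i; simp
    simp [gain, h1]
  simp only [potential, h, Fintype.expect_const]
  rw [iInf, ← Real.sSup_neg, iSup]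
  congr 1
  ext x
  simp [neg_eq_iff_eq_neg]

theorem expectedRegret_le (hB : 0 ≤ B) (hρ : 0 < ρ)
    (hlip : ∀ y ∈ Y, LipschitzOnWith ρ.toNNReal (fun a => ℓ a y) (Set.Icc (-B) B))
    {y : (Fin T → Signs T) → Fin T → ℝ} (hy : IsAdversary Y y) :
    expectedRegret B pos ρ ℓ y ≤ 2 * B * ρ * expectedSpectralNorm pos := by
  set ψ : ℕ → ℝ := fun k => 𝔼 ω, potential B ρ pos ℓ k (y ω) with hψ
  have hreg : expectedRegret B pos ρ ℓ y =
      (∑ t, 𝔼 ω, ℓ (prediction B pos ρ ℓ (ω t) (y ω) t) (y ω t)) + ψ T := by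
    simp only [expectedRegret, regret, hψ, potential_last,
      Finset.expect_neg_distrib, Finset.expect_sum_comm, sub_eq_add_neg,
      Finset.expect_add_distrib]
  have hsum : ∑ t, 𝔼 ω, ℓ (prediction B pos ρ ℓ (ω t) (y ω) t) (y ω t) ≤
      ∑ t : Fin T, (ψ t - ψ (t + 1)) :=
    Finset.sum_le_sum fun t _ => le_sub_iff_add_le.2 (expect_round_le hB hρ hlip hy t)
  rw [Fin.sum_univ_eq_sum_range (fun k => ψ k - ψ (k + 1)), Finset.sum_range_sub'] at hsum
  have h0 : ψ 0 ≤ 2 * B * ρ * expectedSpectralNorm pos :=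
    Finset.expect_le Finset.univ_nonempty fun ω _ => potential_zero_le hB hρ (y ω)
  linarith

end Regret

/-! ### Nets of the unit ball and the spectral norm. -/

/-- `N` is a `1/2`-net of the unit ball consisting of points of the unit ball. -/
structure IsHalfNet {E : Type*} [NormedAddCommGroup E] (N : Finset E) : Prop where
  norm_le : ∀ v ∈ N, ‖v‖ ≤ 1
  exists_near : ∀ x : E, ‖x‖ ≤ 1 → ∃ v ∈ N, ‖x - v‖ ≤ 1 / 2

/-- Scale by `1/2` a `1`-separated subset of the ball of radius `2` of maximal cardinality: a point
far from all of it could be added. The volume bound for such sets gives `5 ^ d`. -/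
lemma exists_isHalfNet_card_le (E : Type*) [NormedAddCommGroup E] [NormedSpace ℝ E]
    [FiniteDimensional ℝ E] :
    ∃ N : Finset E, IsHalfNet N ∧ N.card ≤ 5 ^ Module.finrank ℝ E := by
  classical
  let P : Finset E → Prop := fun S =>
    (∀ c ∈ S, ‖c‖ ≤ 2) ∧ ∀ c ∈ S, ∀ d ∈ S, c ≠ d → 1 ≤ ‖c - d‖
  let C : Set ℕ := {k | ∃ S, P S ∧ S.card = k}
  have hC : BddAbove C := ⟨5 ^ Module.finrank ℝ E, by
    rintro _ ⟨S, hS, rfl⟩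
    exact Besicovitch.card_le_of_separated S hS.1 hS.2⟩
  obtain ⟨S, hS, hcard⟩ : sSup C ∈ C := Nat.sSup_mem ⟨0, ∅, by simp [P], rfl⟩ hC
  refine ⟨S.image fun v => (1 / 2 : ℝ) • v, ⟨?_, ?_⟩,
    Finset.card_image_le.trans (Besicovitch.card_le_of_separated S hS.1 hS.2)⟩
  · intro v hv
    obtain ⟨w, hw, rfl⟩ := Finset.mem_image.1 hv
    rw [norm_smul]
    have := hS.1 w hw
    norm_num
    linarith
  · intro x hx
    suffices h : ∃ w ∈ S, ‖(2 : ℝ) • x - w‖ ≤ 1 by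
      obtain ⟨w, hw, hle⟩ := h
      refine ⟨_, Finset.mem_image_of_mem _ hw, ?_⟩
      have : x - (1 / 2 : ℝ) • w = (1 / 2 : ℝ) • ((2 : ℝ) • x - w) := by
        rw [smul_sub, smul_smul]; norm_num
      rw [this, norm_smul]
      norm_num
      linarith
    by_contra! h
    have hx2 : ‖(2 : ℝ) • x‖ ≤ 2 := by
      rw [norm_smul]; norm_num; linarith
    have hmem : (2 : ℝ) • x ∉ S := fun hm => by
      have := h _ hm
      simp at this
      linarith
    have hP : P (insert ((2 : ℝ) • x) S) := by
      refine ⟨fun c hc => ?_, fun c hc d hd hcd => ?_⟩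
      · rcases Finset.mem_insert.1 hc with rfl | hc
        · exact hx2
        · exact hS.1 c hc
      · rcases Finset.mem_insert.1 hc with rfl | hc <;> rcases Finset.mem_insert.1 hd with rfl | hd
        · exact absurd rfl hcd
        · exact (h d hd).le
        · rw [norm_sub_rev]; exact (h c hc).le
        · exact hS.2 c hc d hd hcd
    have := le_csSup hC ⟨_, hP, rfl⟩
    rw [Finset.card_insert_of_notMem hmem] at this
    omega

lemma IsHalfNet.norm_le_two_mul {E : Type*} [NormedAddCommGroup E] [InnerProductSpace ℝ E]
    {N : Finset E} (hN : IsHalfNet N) {w : E} {c : ℝ} (h : ∀ u ∈ N, ⟪u, w⟫ ≤ c) :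
    ‖w‖ ≤ 2 * c := by
  -- For `w = 0` this vector is `0`, so no separate case is needed here.
  have h1 : ‖‖w‖⁻¹ • w‖ ≤ 1 := by
    rw [norm_smul, norm_inv, norm_norm]
    exact inv_mul_le_one
  have h2 : ⟪‖w‖⁻¹ • w, w⟫ = ‖w‖ := by
    rw [real_inner_smul_left, real_inner_self_eq_norm_sq]
    by_cases hw : ‖w‖ = 0
    · simp [hw]
    · field_simp
  obtain ⟨u, hu, hle⟩ := hN.exists_near _ h1
  have h3 := real_inner_le_norm (‖w‖⁻¹ • w - u) w
  rw [inner_sub_left, h2] at h3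
  have h4 := mul_le_mul_of_nonneg_right hle (norm_nonneg w)
  linarith [h u hu]

/-- Each of the two nets costs a factor `2`: the error of approximation is at most half of the norm
being estimated and is absorbed on the left. -/
lemma spectralNorm_le_of_isHalfNet {N : Finset (EuclideanSpace ℝ (Fin m))}
    {N' : Finset (EuclideanSpace ℝ (Fin n))} (hN : IsHalfNet N) (hN' : IsHalfNet N')
    (X : Matrix (Fin m) (Fin n) ℝ) {c : ℝ} (h : ∀ u ∈ N, ∀ v ∈ N', ⟪u, toMap X v⟫ ≤ c) :
    spectralNorm X ≤ 4 * c := by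
  have hv : ∀ v ∈ N', ‖toMap X v‖ ≤ 2 * c := fun v hv =>
    hN.norm_le_two_mul fun u hu => h u hu v hv
  have hc : 0 ≤ 2 * c := by
    obtain ⟨v, hv', -⟩ := hN'.exists_near 0 (by simp)
    exact (norm_nonneg _).trans (hv v hv')
  have key : spectralNorm X ≤ 2 * c + spectralNorm X * (1 / 2) := by
    refine ContinuousLinearMap.opNorm_le_of_unit_norm
      (add_nonneg hc (mul_nonneg (spectralNorm_nonneg X) (by norm_num))) fun x hx => ?_
    rw [LinearMap.coe_toContinuousLinearMap']
    obtain ⟨v, hvN, hle⟩ := hN'.exists_near x hx.le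
    have hx' : toMap X x = toMap X v + toMap X (x - v) := by rw [map_sub]; abel
    rw [hx']
    refine (norm_add_le _ _).trans (add_le_add (hv v hvN) ?_)
    exact (norm_toMap_apply_le X _).trans
      (mul_le_mul_of_nonneg_left hle (spectralNorm_nonneg X))
  linarith

lemma exp_mul_spectralNorm_le {N : Finset (EuclideanSpace ℝ (Fin m))}
    {N' : Finset (EuclideanSpace ℝ (Fin n))} (hN : IsHalfNet N) (hN' : IsHalfNet N')
    (X : Matrix (Fin m) (Fin n) ℝ) {r : ℝ} (hr : 0 ≤ r) :
    Real.exp (r * spectralNorm X) ≤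
      ∑ p ∈ N ×ˢ N', Real.exp (4 * r * ⟪p.1, toMap X p.2⟫) := by
  have hne : (N ×ˢ N').Nonempty := by
    obtain ⟨u, hu, -⟩ := hN.exists_near 0 (by simp)
    obtain ⟨v, hv, -⟩ := hN'.exists_near 0 (by simp)
    exact ⟨(u, v), Finset.mk_mem_product hu hv⟩
  have hX := fun c => spectralNorm_le_of_isHalfNet hN hN' X (c := c)
  obtain ⟨g, hg⟩ : ∃ g : EuclideanSpace ℝ (Fin m) × EuclideanSpace ℝ (Fin n) → ℝ,
    ∀ p, g p = ⟪p.1, toMap X p.2⟫ := ⟨_, fun _ => rfl⟩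
  obtain ⟨q, hq, hmax⟩ := (N ×ˢ N').exists_max_image g hne
  have h : spectralNorm X ≤ 4 * g q :=
    hX _ fun u hu v hv => (hg (u, v)).ge.trans (hmax (u, v) (Finset.mk_mem_product hu hv))
  simp only [← hg]
  have h' : r * spectralNorm X ≤ 4 * r * g q := by
    linarith [mul_le_mul_of_nonneg_left h hr]
  exact (Real.exp_le_exp.2 h').trans (Finset.single_le_sum
    (f := fun p => Real.exp (4 * r * g p)) (fun _ _ => (Real.exp_pos _).le) hq)

/-! ### Exponential moments and the rate for distinct positions. -/

/-- Independence factors the expectation into a product of `cosh (a t)`, and `cosh x ≤ exp (x ^ 2 /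
2)`. -/
lemma expect_exp_sum_sgn_mul_le (a : Fin T → ℝ) :
    𝔼 ε : Signs T, Real.exp (∑ t, sgn (ε t) * a t) ≤ Real.exp ((∑ t, a t ^ 2) / 2) := by
  have h : 𝔼 ε : Signs T, Real.exp (∑ t, sgn (ε t) * a t) = ∏ t, Real.cosh (a t) := by
    have h1 := Finset.prod_univ_sum (fun _ : Fin T => (Finset.univ : Finset ℤˣ))
      fun t e => Real.exp (sgn e * a t)
    rw [Fintype.piFinset_univ] at h1
    have h2 : ∀ t, ∑ e : ℤˣ, Real.exp (sgn e * a t) = 2 * Real.cosh (a t) := fun t => by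
      rw [Real.cosh_eq, show (Finset.univ : Finset ℤˣ) = {1, -1} from rfl,
        Finset.sum_pair (by decide)]
      simp [sgn]
      ring
    simp only [h2, Finset.prod_mul_distrib, Finset.prod_const, Finset.card_univ,
      Fintype.card_fin] at h1
    rw [Fintype.expect_eq_sum_div_card]
    simp only [Real.exp_sum, ← h1]
    simp
  rw [h, Finset.sum_div, Real.exp_sum]
  exact Finset.prod_le_prod (fun t _ => (Real.cosh_pos _).le)
    fun t _ => Real.cosh_le_exp_half_sq _

lemma inner_toMap_sum_smul_entry (pos : Fin T → Fin m × Fin n) (c : Fin T → ℝ)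
    (u : EuclideanSpace ℝ (Fin m)) (v : EuclideanSpace ℝ (Fin n)) :
    ⟪u, toMap (∑ t, c t • entry (pos t)) v⟫ = ∑ t, c t * (u (pos t).1 * v (pos t).2) := by
  have h : toMap (∑ t, c t • entry (pos t)) v = ∑ t, c t • toMap (entry (pos t)) v := by
    simp [toMap, map_sum]
  rw [h, inner_sum]
  refine Finset.sum_congr rfl fun t _ => ?_
  rw [toMap_entry_apply, real_inner_smul_right, real_inner_smul_right,
    EuclideanSpace.inner_single_right]
  simp [mul_comm]

/-- Distinct positions make this a partial sum of `‖u‖ ^ 2 * ‖v‖ ^ 2`; this is the only use of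
injectivity in the moment bound. -/
lemma sum_sq_mul_le_one {pos : Fin T → Fin m × Fin n} (hpos : Function.Injective pos)
    {u : EuclideanSpace ℝ (Fin m)} {v : EuclideanSpace ℝ (Fin n)} (hu : ‖u‖ ≤ 1) (hv : ‖v‖ ≤ 1) :
    ∑ t, (u (pos t).1 * v (pos t).2) ^ 2 ≤ 1 := by
  calc ∑ t, (u (pos t).1 * v (pos t).2) ^ 2
      = ∑ p ∈ Finset.univ.map ⟨pos, hpos⟩, (u p.1 * v p.2) ^ 2 := by simp
    _ ≤ ∑ p : Fin m × Fin n, (u p.1 * v p.2) ^ 2 :=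
        Finset.sum_le_sum_of_subset_of_nonneg (Finset.subset_univ _) fun _ _ _ => sq_nonneg _
    _ = ‖u‖ ^ 2 * ‖v‖ ^ 2 := by
        simp only [EuclideanSpace.real_norm_sq_eq, Finset.sum_mul_sum, mul_pow,
          Fintype.sum_prod_type]
    _ ≤ 1 := mul_le_one₀ (pow_le_one₀ (norm_nonneg u) hu) (sq_nonneg _)
        (pow_le_one₀ (norm_nonneg v) hv)

/-- Union bound over pairs of net points; the exponent is `(4 * r) ^ 2 / 2 = 8 * r ^ 2`. -/
lemma expect_exp_mul_spectralNorm_le {pos : Fin T → Fin m × Fin n}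
    (hpos : Function.Injective pos) {r : ℝ} (hr : 0 ≤ r) :
    𝔼 ε : Signs T, Real.exp (r * spectralNorm (∑ t, sgn (ε t) • entry (pos t))) ≤
      5 ^ (m + n) * Real.exp (8 * r ^ 2) := by
  obtain ⟨N, hN, hcard⟩ := exists_isHalfNet_card_le (EuclideanSpace ℝ (Fin m))
  obtain ⟨N', hN', hcard'⟩ := exists_isHalfNet_card_le (EuclideanSpace ℝ (Fin n))
  rw [finrank_euclideanSpace_fin] at hcard hcard'
  calc _ ≤ 𝔼 ε : Signs T, ∑ p ∈ N ×ˢ N',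
        Real.exp (4 * r * ⟪p.1, toMap (∑ t, sgn (ε t) • entry (pos t)) p.2⟫) :=
        Finset.expect_le_expect fun ε _ => exp_mul_spectralNorm_le hN hN' _ hr
    _ = ∑ p ∈ N ×ˢ N', 𝔼 ε : Signs T,
        Real.exp (∑ t, sgn (ε t) * (4 * r * (p.1 (pos t).1 * p.2 (pos t).2))) := by
        rw [Finset.expect_sum_comm]
        refine Finset.sum_congr rfl fun p _ => Finset.expect_congr rfl fun ε _ => ?_
        rw [inner_toMap_sum_smul_entry, Finset.mul_sum]
        congr 1
        exact Finset.sum_congr rfl fun t _ => by ring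
    _ ≤ ∑ p ∈ N ×ˢ N', Real.exp (8 * r ^ 2) := by
        refine Finset.sum_le_sum fun p hp => (expect_exp_sum_sgn_mul_le _).trans ?_
        rw [Finset.mem_product] at hp
        have h := sum_sq_mul_le_one hpos (hN.norm_le _ hp.1) (hN'.norm_le _ hp.2)
        simp only [mul_pow _ (_ * _ : ℝ), ← Finset.mul_sum] at h ⊢
        refine Real.exp_le_exp.2 ?_
        have h' := mul_le_mul_of_nonneg_left h (by positivity : 0 ≤ 8 * r ^ 2)
        linarith
    _ = ((N.card * N'.card : ℕ) : ℝ) * Real.exp (8 * r ^ 2) := by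
        rw [Finset.sum_const, Finset.card_product, nsmul_eq_mul]
    _ ≤ 5 ^ (m + n) * Real.exp (8 * r ^ 2) := by
        refine mul_le_mul_of_nonneg_right ?_ (Real.exp_pos _).le
        rw [pow_add]
        exact_mod_cast Nat.mul_le_mul hcard hcard'

theorem expectedSpectralNorm_le {pos : Fin T → Fin m × Fin n} (hpos : Function.Injective pos) :
    expectedSpectralNorm pos ≤ 10 * (√(m : ℝ) + √(n : ℝ)) := by
  rcases (Nat.zero_le (m + n)).eq_or_lt with h0 | h0
  · have hm : m = 0 := by omega
    subst hm
    have : IsEmpty (Fin T) := ⟨fun t => (pos t).1.elim0⟩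
    have h : expectedSpectralNorm pos = 0 := by
      simp [expectedSpectralNorm, spectralNorm, toMap]
    rw [h]
    positivity
  have hd : (0 : ℝ) < m + n := by exact_mod_cast h0
  -- This `r` balances the entropy `(m + n) * log 5 ≤ 2 * r ^ 2` against the variance term `8 * r ^
  -- 2`; together they give `a = 10 * r ^ 2`.
  set r : ℝ := √(m + n) with hr
  have hr0 : 0 < r := Real.sqrt_pos.2 hd
  have hr2 : r ^ 2 = m + n := Real.sq_sqrt hd.le
  set a : ℝ := 10 * r ^ 2 with ha
  have h5 : (5 : ℝ) ^ (m + n) * Real.exp (8 * r ^ 2) ≤ Real.exp a := by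
    have h1 : (5 : ℝ) ≤ Real.exp 2 := by
      have h := Real.exp_one_gt_d9
      have h' : Real.exp 2 = Real.exp 1 ^ 2 := by rw [← Real.exp_nat_mul]; norm_num
      rw [h']
      nlinarith
    have h2 : (5 : ℝ) ^ (m + n) ≤ Real.exp (2 * r ^ 2) := by
      refine (pow_le_pow_left₀ (by norm_num) h1 _).trans_eq ?_
      rw [← Real.exp_nat_mul, hr2]
      push_cast
      ring_nf
    refine (mul_le_mul_of_nonneg_right h2 (Real.exp_pos _).le).trans_eq ?_
    rw [← Real.exp_add, ha]
    ring_nf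
  have hexp := (expect_exp_mul_spectralNorm_le hpos hr0.le).trans h5
  have hle : r * expectedSpectralNorm pos ≤ a := by
    rw [expectedSpectralNorm, Finset.mul_expect]
    calc _ ≤ 𝔼 ε : Signs T, (a - 1 + Real.exp (-a) *
          Real.exp (r * spectralNorm (∑ t, sgn (ε t) • entry (pos t)))) := by
          refine Finset.expect_le_expect fun ε _ => ?_
          -- The tangent to `exp` at `a` replaces Jensen's inequality: `x ≤ a - 1 + exp (-a) * exp
          -- x`.
          have h := Real.add_one_le_exp
            (-a + r * spectralNorm (∑ t, sgn (ε t) • entry (pos t)))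
          rw [Real.exp_add] at h
          linarith
      _ = a - 1 + Real.exp (-a) * 𝔼 ε : Signs T,
          Real.exp (r * spectralNorm (∑ t, sgn (ε t) • entry (pos t))) := by
          rw [Finset.expect_add_distrib, Fintype.expect_const, Finset.mul_expect]
      _ ≤ a - 1 + Real.exp (-a) * Real.exp a := by gcongr
      _ = a := by rw [← Real.exp_add]; simp
  have h10 : expectedSpectralNorm pos ≤ 10 * r :=
    le_of_mul_le_mul_left (hle.trans_eq (by rw [ha]; ring)) hr0
  refine h10.trans (mul_le_mul_of_nonneg_left (Real.sqrt_le_iff.2 ⟨by positivity, ?_⟩)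
    (by norm_num))
  rw [add_sq, Real.sq_sqrt (Nat.cast_nonneg m), Real.sq_sqrt (Nat.cast_nonneg n)]
  linarith [mul_nonneg (Real.sqrt_nonneg (m : ℝ)) (Real.sqrt_nonneg (n : ℝ))]

end MatrixCompletion

end

theorem mainTheorem12 :
    ∃ C : ℝ, 0 < C ∧
      ∀ (m n T : ℕ) (pos : Fin T → Fin m × Fin n) (B ρ : ℝ) (Y : Set ℝ) (ℓ : ℝ → ℝ → ℝ),
        0 ≤ B → 0 < ρ →
        (∀ y ∈ Y, ConvexOn ℝ (Set.Icc (-B) B) (fun a => ℓ a y)) →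
        (∀ y ∈ Y, LipschitzOnWith ρ.toNNReal (fun a => ℓ a y) (Set.Icc (-B) B)) →
        -- each prediction is obtained from the solutions of two trace-norm-constrained
        -- convex programs
        (∀ (t : Fin T) (ε : MatrixCompletion.Signs T) (y : Fin T → ℝ), (∀ i, y i ∈ Y) →
          Convex ℝ (MatrixCompletion.traceBall m n B) ∧
          ConvexOn ℝ (MatrixCompletion.traceBall m n B)
            (MatrixCompletion.objective pos ρ ℓ ε y t 1) ∧
          ConvexOn ℝ (MatrixCompletion.traceBall m n B)
            (MatrixCompletion.objective pos ρ ℓ ε y t (-1)) ∧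
          ∃ f ∈ MatrixCompletion.traceBall m n B, ∃ g ∈ MatrixCompletion.traceBall m n B,
            IsMinOn (MatrixCompletion.objective pos ρ ℓ ε y t 1)
              (MatrixCompletion.traceBall m n B) f ∧
            IsMinOn (MatrixCompletion.objective pos ρ ℓ ε y t (-1))
              (MatrixCompletion.traceBall m n B) g ∧
            MatrixCompletion.prediction B pos ρ ℓ ε y t =
              MatrixCompletion.objective pos ρ ℓ ε y t 1 f
                - MatrixCompletion.objective pos ρ ℓ ε y t (-1) g) ∧
        -- the regret bound, against every adaptive adversary
        (∀ y : (Fin T → MatrixCompletion.Signs T) → Fin T → ℝ,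
          MatrixCompletion.IsAdversary Y y →
            MatrixCompletion.expectedRegret B pos ρ ℓ y ≤
              2 * B * ρ * MatrixCompletion.expectedSpectralNorm pos) ∧
        -- the rate, when no entry is asked for twice
        (Function.Injective pos →
          2 * B * ρ * MatrixCompletion.expectedSpectralNorm pos ≤
            C * (B * ρ * (√(m : ℝ) + √(n : ℝ)))) := by
  open MatrixCompletion in
  refine ⟨20, by norm_num, fun m n T pos B ρ Y ℓ hB hρ hconv hlip => ⟨?_, ?_, ?_⟩⟩
  · intro t ε y hy
    obtain ⟨f, hf, hfmin, hfval⟩ :=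
      exists_isMinOn_traceBall hB (continuousOn_objective hlip pos ε hy t 1)
    obtain ⟨g, hg, hgmin, hgval⟩ :=
      exists_isMinOn_traceBall hB (continuousOn_objective hlip pos ε hy t (-1))
    exact ⟨convex_traceBall m n B, convexOn_objective hρ hconv pos ε hy t 1,
      convexOn_objective hρ hconv pos ε hy t (-1), f, hf, g, hg, hfmin, hgmin,
      by rw [prediction, hfval, hgval]⟩
  · exact fun y hy => expectedRegret_le hB hρ hlip hy
  · intro hpos
    have h := mul_le_mul_of_nonneg_left (expectedSpectralNorm_le hpos)
      (by positivity : 0 ≤ 2 * B * ρ)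
    linarith
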